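/- Let $q$ be a prime. A $\mathbb{Z}_q$-order in $M_2(\mathbb{Q}_q)$ is a subring containing $\mathbb{Z}_q$ that is finitely generated as a $\mathbb{Z}_q$-module and spans $M_2(\mathbb{Q}_q)$ over $\mathbb{Q}_q$; a maximal order is an order that is maximal under inclusion. For maximal orders $\Lambda,\Lambda'$, let $d(\Lambda,\Lambda')$ be their distance in the Bruhat-Tits tree, the graph whose vertices are the maximal orders of $M_2(\mathbb{Q}_q)$ and in which $\Lambda$ and $\Lambda'$ are adjacent if and only if $[\Lambda:\Lambda\cap\Lambda']=[\Lambda':\Lambda\cap\Lambda']=q$. For a finite non-empty set $S$ of maximal orders put \[ d_3(S)=\max\{d(\Lambda_1,\Lambda_2)+d(\Lambda_2,\Lambda_3)+d(\Lambda_3,\Lambda_1)\}, \] where the maximum is over all (not necessarily distinct) $\Lambda_1,\Lambda_2,\Lambda_3\in S$. The reduced discriminant $\operatorname{discrd}(\Lambda)$ of an order $\Lambda$ with $\mathbb{Z}_q$-basis $\beta_1,\dots,\beta_4$ is the element of $\mathbb{Z}_q$, defined up to units, whose square is $\det(\operatorname{tr}(\beta_i\beta_j))_{i,j}$ up to a unit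 of $\mathbb{Z}_q$. Then for every finite non-empty set $S$ of maximal orders in $M_2(\mathbb{Q}_q)$, the intersection $\bigcap_{\Lambda\in S}\Lambda$ is an order, its reduced discriminant exists and is non-zero, and \[ v_q\Bigl(\operatorname{discrd}\Bigl(\bigcap_{\Lambda\in S}\Lambda\Bigr)\Bigr)=\frac{d_3(S)}{2}. \] -/

import Mathlib

/-- A `ℤ_q`-order in `M_2(ℚ_q)`: a subring containing `ℤ_q` which is a `ℤ_q`-lattice, that is,
finitely generated over `ℤ_q` and spanning `M_2(ℚ_q)` over `ℚ_q`. -/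
def IsLocalOrder (q : ℕ) [Fact q.Prime]
    (Λ : Subalgebra ℤ_[q] (Matrix (Fin 2) (Fin 2) ℚ_[q])) : Prop :=
  Submodule.IsLattice ℚ_[q] (Subalgebra.toSubmodule Λ)

/-- The maximal orders of `M_2(ℚ_q)`: orders that are maximal under inclusion among all orders. -/
abbrev MaxOrder (q : ℕ) [Fact q.Prime] : Type :=
  {Λ : Subalgebra ℤ_[q] (Matrix (Fin 2) (Fin 2) ℚ_[q]) // Maximal (IsLocalOrder q) Λ}

/-- The index `[M : M ∩ N]` of additive groups. -/
noncomputable def orderIndex {q : ℕ} [Fact q.Prime]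
    (M N : Subalgebra ℤ_[q] (Matrix (Fin 2) (Fin 2) ℚ_[q])) : ℕ :=
  (Subalgebra.toSubmodule (M ⊓ N)).toAddSubgroup.relIndex (Subalgebra.toSubmodule M).toAddSubgroup

/-- The Bruhat-Tits tree: the vertices are the maximal orders of `M_2(ℚ_q)`, and `Λ`, `Λ'` are
neighbours when `[Λ : Λ ∩ Λ'] = [Λ' : Λ ∩ Λ'] = q`. -/
def bruhatTitsTree (q : ℕ) [Fact q.Prime] : SimpleGraph (MaxOrder q) where
  Adj Λ Λ' := orderIndex Λ.1 Λ'.1 = q ∧ orderIndex Λ'.1 Λ.1 = q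
  symm := ⟨fun _ _ h => ⟨h.2, h.1⟩⟩
  loopless := ⟨fun Λ h => (Fact.out : q.Prime).ne_one (by
    have h1 := h.1
    simp only [orderIndex, inf_idem, AddSubgroup.relIndex_self] at h1
    exact h1.symm)⟩

/-- `d_3(S)`: the maximum of `d(Λ₁, Λ₂) + d(Λ₂, Λ₃) + d(Λ₃, Λ₁)` over all `Λ₁, Λ₂, Λ₃ ∈ S`,
not necessarily distinct, where `d` is the distance in the Bruhat-Tits tree. -/
noncomputable def d3 {q : ℕ} [Fact q.Prime] (S : Finset (MaxOrder q)) : ℕ :=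
  (S ×ˢ S ×ˢ S).sup fun t =>
    (bruhatTitsTree q).dist t.1 t.2.1 + (bruhatTitsTree q).dist t.2.1 t.2.2 +
      (bruhatTitsTree q).dist t.2.2 t.1

/-- `Δ ∈ ℤ_q` is a reduced discriminant of `Λ`: for some `ℤ_q`-basis `b₁, …, b₄` of `Λ`, `Δ²` is
the discriminant `det (trd (bᵢ bⱼ))` up to a unit of `ℤ_q`. The reduced trace of `M_2(ℚ_q)` is the
matrix trace. -/
def IsReducedDiscriminant {q : ℕ} [Fact q.Prime]
    (Λ : Subalgebra ℤ_[q] (Matrix (Fin 2) (Fin 2) ℚ_[q])) (Δ : ℤ_[q]) : Prop :=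
  ∃ (b : Module.Basis (Fin 4) ℤ_[q] Λ) (u : ℤ_[q]ˣ),
    (Δ : ℚ_[q]) ^ 2 = ((u : ℤ_[q]) : ℚ_[q]) *
      (Matrix.of fun i j : Fin 4 =>
        Matrix.trace ((b i : Matrix (Fin 2) (Fin 2) ℚ_[q]) *
          (b j : Matrix (Fin 2) (Fin 2) ℚ_[q]))).det

/-! Every maximal order of `M_2(ℚ_q)` is conjugate to `M_2(ℤ_q)`, and the Hermite normal form of the
conjugating matrix names it by a ball `a + q ^ n ℤ_q` of `ℚ_q` (`exists_eq_ballVertex`); membership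
in the order of a ball is a list of four congruences (`mem_ballOrder`). If `k` is the level of the
smallest ball containing the balls of two vertices of levels `n` and `m`, an affine map, possibly
combined with the inversion `x ↦ x⁻¹`, carries the two balls to `ℤ_q` and `q ^ D ℤ_q` with
`D = n + m - 2 k` (`exists_conj_ballVertex`).

The index `[Λ : Λ ∩ Λ']` of such a pair is `q ^ D`. As the index is submultiplicative along paths
and is `q` on edges, while consecutive balls `q ^ i ℤ_q` give a path of length `D`, the distance
in the tree is `D` (`dist_eq_of_conj`). So distances are given by `n + m - 2 k`.

For the intersection, conjugate so that two members of `S` at maximal distance `d` are the balls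
`ℤ_q` and `q ^ d ℤ_q`. Maximality of `d` forces any other member of `S` to hang off the path between
them, at some depth `c` bounded by the distances from its foot to both ends of the path. On the
Eichler order of the path, the order of this member imposes only the congruence
`X₀₀ ≡ X₁₁` modulo `q ^ c` (`mem_ballOrder_iff_of_mem`). Hence the intersection is governed by the
largest depth `c`; it has an explicit basis with discriminant `-(q ^ (c + d)) ^ 2`. On the other
side the ultrametric inequality bounds the perimeter of every triple by `2 (c + d)`, and the two
ends of the path together with a member of depth `c` attain it (`exists_map_iInf_eq_span`). -/

/-! ### Powers of the maximal ideal of `ℤ_q` -/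

/-- The fractional ideal `q ^ n ℤ_q` of `ℚ_q`, for `n : ℤ`, described by the norm. -/
def fracIdeal (q : ℕ) [Fact q.Prime] (n : ℤ) : Submodule ℤ_[q] ℚ_[q] where
  carrier := {x | ‖x‖ ≤ (q : ℝ) ^ (-n)}
  add_mem' {x y} hx hy := (Padic.nonarchimedean x y).trans (max_le hx hy)
  zero_mem' := by simp only [Set.mem_ofPred_eq, norm_zero]; positivity
  smul_mem' c x hx := by
    simp only [Set.mem_ofPred_eq, Algebra.smul_def, norm_mul] at *
    calc _ ≤ 1 * ‖x‖ := by gcongr; exact c.2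
      _ ≤ _ := by simpa using hx

section
variable {q : ℕ} [Fact q.Prime]

theorem mem_fracIdeal {n : ℤ} {x : ℚ_[q]} : x ∈ fracIdeal q n ↔ ‖x‖ ≤ (q : ℝ) ^ (-n) := Iff.rfl

theorem one_lt_cast_prime (q : ℕ) [hq : Fact q.Prime] : (1 : ℝ) < q := by
  exact_mod_cast hq.out.one_lt

theorem cast_prime_ne_zero (q : ℕ) [hq : Fact q.Prime] : (q : ℚ_[q]) ≠ 0 := by
  exact_mod_cast hq.out.ne_zero

theorem fracIdeal_mono {n m : ℤ} (h : m ≤ n) {x : ℚ_[q]} (hx : x ∈ fracIdeal q n) :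
    x ∈ fracIdeal q m :=
  (mem_fracIdeal.1 hx).trans (zpow_le_zpow_right₀ (one_lt_cast_prime q).le (by omega))

theorem mul_mem_fracIdeal {n m k : ℤ} {x y : ℚ_[q]} (hx : x ∈ fracIdeal q n)
    (hy : y ∈ fracIdeal q m) (h : k ≤ n + m) : x * y ∈ fracIdeal q k := by
  refine fracIdeal_mono h ?_
  rw [mem_fracIdeal, norm_mul, neg_add, zpow_add₀ (by linarith [one_lt_cast_prime q])]
  exact mul_le_mul hx hy (norm_nonneg _) (by positivity)

theorem mem_fracIdeal_iff_le_valuation {n : ℤ} {x : ℚ_[q]} (hx : x ≠ 0) :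
    x ∈ fracIdeal q n ↔ n ≤ x.valuation := by
  rw [mem_fracIdeal, Padic.norm_eq_zpow_neg_valuation hx,
    zpow_le_zpow_iff_right₀ (one_lt_cast_prime q), neg_le_neg_iff]

theorem mem_fracIdeal_valuation (x : ℚ_[q]) : x ∈ fracIdeal q x.valuation := by
  by_cases hx : x = 0
  · simp [hx]
  · exact (mem_fracIdeal_iff_le_valuation hx).2 le_rfl

theorem zpow_mem_fracIdeal {n m : ℤ} : (q : ℚ_[q]) ^ m ∈ fracIdeal q n ↔ n ≤ m := by
  rw [mem_fracIdeal, Padic.norm_p_zpow, zpow_le_zpow_iff_right₀ (one_lt_cast_prime q),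
    neg_le_neg_iff]

theorem zpow_mul_mem_fracIdeal {n m : ℤ} {x : ℚ_[q]} :
    (q : ℚ_[q]) ^ m * x ∈ fracIdeal q n ↔ x ∈ fracIdeal q (n - m) := by
  have hq := cast_prime_ne_zero q
  constructor <;> intro h
  · have := mul_mem_fracIdeal (k := n - m) (zpow_mem_fracIdeal.2 (le_refl (-m))) h (by omega)
    rwa [← mul_assoc, ← zpow_add₀ hq, neg_add_cancel, zpow_zero, one_mul] at this
  · exact mul_mem_fracIdeal (zpow_mem_fracIdeal.2 (le_refl m)) h (by omega)

theorem inv_mem_fracIdeal {x : ℚ_[q]} : x⁻¹ ∈ fracIdeal q (-x.valuation) := by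
  by_cases hx : x = 0
  · simp [hx]
  · rw [mem_fracIdeal_iff_le_valuation (inv_ne_zero hx), Padic.valuation_inv]

theorem one_mem_fracIdeal_zero : (1 : ℚ_[q]) ∈ fracIdeal q 0 := by
  simp [mem_fracIdeal]

theorem mem_fracIdeal_zero_iff {x : ℚ_[q]} : x ∈ fracIdeal q 0 ↔ ∃ c : ℤ_[q], (c : ℚ_[q]) = x := by
  rw [mem_fracIdeal]
  simp only [neg_zero, zpow_zero]
  exact ⟨fun h => ⟨⟨x, h⟩, rfl⟩, by rintro ⟨c, rfl⟩; exact c.2⟩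

theorem mem_fracIdeal_iff_exists_zpow {n : ℤ} {x : ℚ_[q]} :
    x ∈ fracIdeal q n ↔ ∃ c : ℤ_[q], x = c * (q : ℚ_[q]) ^ n := by
  have hq := cast_prime_ne_zero q
  constructor
  · intro h
    have h' : (q : ℚ_[q]) ^ (-n) * x ∈ fracIdeal q 0 := by
      rw [zpow_mul_mem_fracIdeal]; exact fracIdeal_mono (by omega) h
    obtain ⟨c, hc⟩ := mem_fracIdeal_zero_iff.1 h'
    refine ⟨c, ?_⟩
    rw [hc, mul_right_comm, ← zpow_add₀ hq]; simp
  · rintro ⟨c, rfl⟩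
    exact mul_mem_fracIdeal (mem_fracIdeal_zero_iff.2 ⟨c, rfl⟩) (zpow_mem_fracIdeal.2 le_rfl)
      (by omega)

/-- The index of `q ^ n ℤ_q` in `ℤ_q` is `q ^ n`, since the quotient is `ZMod (q ^ n)`. -/
theorem relIndex_fracIdeal (n : ℕ) :
    (fracIdeal q n).toAddSubgroup.relIndex (fracIdeal q 0).toAddSubgroup = q ^ n := by
  let f : ℤ_[q] →+ ℚ_[q] := (PadicInt.Coe.ringHom : ℤ_[q] →+* ℚ_[q])
  have h0 : (fracIdeal q 0).toAddSubgroup = (⊤ : AddSubgroup ℤ_[q]).map f := by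
    ext x
    simp only [Submodule.mem_toAddSubgroup, mem_fracIdeal_zero_iff, AddSubgroup.mem_map,
      AddSubgroup.mem_top, true_and]
    rfl
  have h1 : (fracIdeal q n).toAddSubgroup.comap f =
      (PadicInt.toZModPow n : ℤ_[q] →+* ZMod (q ^ n)).toAddMonoidHom.ker := by
    ext x
    rw [AddMonoidHom.mem_ker]
    change (x : ℚ_[q]) ∈ fracIdeal q n ↔ x ∈ RingHom.ker (PadicInt.toZModPow n)
    rw [PadicInt.ker_toZModPow, ← PadicInt.norm_le_pow_iff_mem_span_pow, mem_fracIdeal,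
      PadicInt.norm_def]
  rw [h0, ← AddSubgroup.relIndex_comap, AddSubgroup.relIndex_top_right, h1,
    AddSubgroup.index_ker]
  have : Function.Surjective (PadicInt.toZModPow n : ℤ_[q] →+* ZMod (q ^ n)).toAddMonoidHom :=
    ZMod.ringHom_surjective _
  rw [AddMonoidHom.range_eq_top.2 this]
  simp

/-! ### Conjugation of orders -/

/-- Conjugation `x ↦ g x g⁻¹` by a unit of an algebra, as an algebra automorphism. -/
def conjEquiv (R : Type*) {A : Type*} [CommSemiring R] [Ring A] [Algebra R A] (g : Aˣ) :
    A ≃ₐ[R] A where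
  toFun x := g * x * ↑g⁻¹
  invFun x := ↑g⁻¹ * x * g
  left_inv x := by simp [mul_assoc]
  right_inv x := by simp [mul_assoc]
  map_mul' x y := by simp [mul_assoc]
  map_add' x y := by simp [mul_add, add_mul]
  commutes' r := by rw [← Algebra.commutes, mul_assoc, Units.mul_inv, mul_one]

theorem mem_map_conjEquiv {R A : Type*} [CommSemiring R] [Ring A] [Algebra R A] (g : Aˣ)
    {Λ : Subalgebra R A} {x : A} :
    x ∈ Λ.map (conjEquiv R g).toAlgHom ↔ ↑g⁻¹ * x * g ∈ Λ := by
  constructor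
  · rintro ⟨y, hy, rfl⟩
    have : (↑g⁻¹ : A) * (g * y * ↑g⁻¹) * g = y := by simp [mul_assoc]
    change (↑g⁻¹ : A) * (g * y * ↑g⁻¹) * g ∈ Λ
    rwa [this]
  · intro h
    exact ⟨_, h, (conjEquiv R g).apply_symm_apply x⟩

theorem map_conjEquiv_mul {R A : Type*} [CommSemiring R] [Ring A] [Algebra R A] (g h : Aˣ)
    (Λ : Subalgebra R A) :
    Λ.map (conjEquiv R (g * h)).toAlgHom =
      (Λ.map (conjEquiv R h).toAlgHom).map (conjEquiv R g).toAlgHom := by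
  ext x
  simp only [mem_map_conjEquiv, mul_inv_rev, Units.val_mul, mul_assoc]

theorem map_conjEquiv_one {R A : Type*} [CommSemiring R] [Ring A] [Algebra R A]
    (Λ : Subalgebra R A) : Λ.map (conjEquiv R (1 : Aˣ)).toAlgHom = Λ := by
  ext x
  rw [mem_map_conjEquiv]
  simp

theorem map_conjEquiv_mono {R A : Type*} [CommSemiring R] [Ring A] [Algebra R A] (g : Aˣ)
    {Λ Λ' : Subalgebra R A} (h : Λ ≤ Λ') :
    Λ.map (conjEquiv R g).toAlgHom ≤ Λ'.map (conjEquiv R g).toAlgHom :=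
  Subalgebra.map_mono h

theorem map_conjEquiv_le_iff {R A : Type*} [CommSemiring R] [Ring A] [Algebra R A] (g : Aˣ)
    {Λ Λ' : Subalgebra R A} :
    Λ.map (conjEquiv R g).toAlgHom ≤ Λ' ↔ Λ ≤ Λ'.map (conjEquiv R g⁻¹).toAlgHom := by
  constructor
  · intro h
    have := map_conjEquiv_mono g⁻¹ h
    rwa [← map_conjEquiv_mul, inv_mul_cancel, map_conjEquiv_one] at this
  · intro h
    have := map_conjEquiv_mono g h
    rwa [← map_conjEquiv_mul, mul_inv_cancel, map_conjEquiv_one] at this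

theorem IsLocalOrder.map_conjEquiv {Λ : Subalgebra ℤ_[q] (Matrix (Fin 2) (Fin 2) ℚ_[q])}
    (h : IsLocalOrder q Λ) (g : (Matrix (Fin 2) (Fin 2) ℚ_[q])ˣ) :
    IsLocalOrder q (Λ.map (conjEquiv ℤ_[q] g).toAlgHom) := by
  constructor
  · rw [Subalgebra.map_toSubmodule]
    exact h.fg.map _
  · have h1 : ((Subalgebra.toSubmodule (Λ.map (conjEquiv ℤ_[q] g).toAlgHom)) :
        Set (Matrix (Fin 2) (Fin 2) ℚ_[q])) =
        (conjEquiv ℚ_[q] g).toLinearMap '' (Subalgebra.toSubmodule Λ) := rfl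
    rw [h1, Submodule.span_image, h.span_eq_top, Submodule.map_top, LinearMap.range_eq_top]
    exact (conjEquiv ℚ_[q] g).surjective

theorem orderIndex_map_conjEquiv (M N : Subalgebra ℤ_[q] (Matrix (Fin 2) (Fin 2) ℚ_[q]))
    (g : (Matrix (Fin 2) (Fin 2) ℚ_[q])ˣ) :
    orderIndex (M.map (conjEquiv ℤ_[q] g).toAlgHom) (N.map (conjEquiv ℤ_[q] g).toAlgHom) =
      orderIndex M N := by
  have hinj : Function.Injective (conjEquiv ℤ_[q] g).toAlgHom := (conjEquiv ℤ_[q] g).injective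
  have key (Λ : Subalgebra ℤ_[q] (Matrix (Fin 2) (Fin 2) ℚ_[q])) :
      (Subalgebra.toSubmodule (Λ.map (conjEquiv ℤ_[q] g).toAlgHom)).toAddSubgroup =
        (Subalgebra.toSubmodule Λ).toAddSubgroup.map
          ((conjEquiv ℤ_[q] g).toAlgHom : _ →+ Matrix (Fin 2) (Fin 2) ℚ_[q]) := by
    ext x; rfl
  unfold orderIndex
  rw [← Algebra.map_inf _ hinj, key, key]
  exact AddSubgroup.relIndex_map_map_of_injective _ _ hinj

/-- Conjugation by `g` as an action on the vertices of the tree. -/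
noncomputable def MaxOrder.conj (g : (Matrix (Fin 2) (Fin 2) ℚ_[q])ˣ) (Λ : MaxOrder q) :
    MaxOrder q :=
  ⟨Λ.1.map (conjEquiv ℤ_[q] g).toAlgHom, Λ.2.1.map_conjEquiv g, fun M hM hle => by
    rw [map_conjEquiv_le_iff] at hle
    have := Λ.2.2 (hM.map_conjEquiv g⁻¹) hle
    rwa [map_conjEquiv_le_iff, inv_inv] at this⟩

@[simp] theorem MaxOrder.coe_conj (g : (Matrix (Fin 2) (Fin 2) ℚ_[q])ˣ) (Λ : MaxOrder q) :
    (Λ.conj g).1 = Λ.1.map (conjEquiv ℤ_[q] g).toAlgHom := rfl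

theorem MaxOrder.conj_mul (g h : (Matrix (Fin 2) (Fin 2) ℚ_[q])ˣ) (Λ : MaxOrder q) :
    Λ.conj (g * h) = (Λ.conj h).conj g := Subtype.ext (map_conjEquiv_mul g h Λ.1)

theorem MaxOrder.conj_one (Λ : MaxOrder q) : Λ.conj 1 = Λ := Subtype.ext (map_conjEquiv_one Λ.1)

theorem MaxOrder.eq_of_le {Λ Λ' : MaxOrder q} (h : Λ.1 ≤ Λ'.1) : Λ = Λ' :=
  Subtype.ext (Λ.2.eq_of_le Λ'.2.1 h)

theorem MaxOrder.orderIndex_conj (g : (Matrix (Fin 2) (Fin 2) ℚ_[q])ˣ) (Λ Λ' : MaxOrder q) :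
    orderIndex (Λ.conj g).1 (Λ'.conj g).1 = orderIndex Λ.1 Λ'.1 :=
  orderIndex_map_conjEquiv _ _ g

/-! ### Orders attached to balls -/

/-- The order `M_2(ℤ_q)`. -/
def integralOrder (q : ℕ) [Fact q.Prime] : Subalgebra ℤ_[q] (Matrix (Fin 2) (Fin 2) ℚ_[q]) where
  carrier := {X | ∀ i j, X i j ∈ fracIdeal q 0}
  mul_mem' {X Y} hX hY i j := by
    rw [Matrix.mul_apply]
    exact Submodule.sum_mem _ fun k _ => mul_mem_fracIdeal (hX i k) (hY k j) (by simp)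
  add_mem' {X Y} hX hY i j := Submodule.add_mem _ (hX i j) (hY i j)
  algebraMap_mem' r i j := by
    rw [Matrix.algebraMap_matrix_apply]
    split_ifs
    · exact mem_fracIdeal_zero_iff.2 ⟨r, rfl⟩
    · exact Submodule.zero_mem _

/-- The matrix of the affine map `x ↦ q ^ n x + a`, which carries `ℤ_q` to the ball
`a + q ^ n ℤ_q`. -/
noncomputable def ballMatrix (a : ℚ_[q]) (n : ℤ) : (Matrix (Fin 2) (Fin 2) ℚ_[q])ˣ where
  val := !![(q : ℚ_[q]) ^ n, a; 0, 1]
  inv := !![(q : ℚ_[q]) ^ (-n), -a * (q : ℚ_[q]) ^ (-n); 0, 1]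
  val_inv := by
    have hq := zpow_ne_zero n (cast_prime_ne_zero q)
    ext i j
    fin_cases i <;> fin_cases j <;> simp [Matrix.mul_apply, Fin.sum_univ_two] <;> field_simp
    all_goals ring
  inv_val := by
    have hq := zpow_ne_zero n (cast_prime_ne_zero q)
    ext i j
    fin_cases i <;> fin_cases j <;> simp [Matrix.mul_apply, Fin.sum_univ_two] <;> field_simp
    all_goals ring

/-- The maximal order attached to the ball `a + q ^ n ℤ_q`: the conjugate of `M_2(ℤ_q)` by the
affine map carrying `ℤ_q` to that ball. -/
noncomputable def ballOrder (a : ℚ_[q]) (n : ℤ) :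
    Subalgebra ℤ_[q] (Matrix (Fin 2) (Fin 2) ℚ_[q]) :=
  (integralOrder q).map (conjEquiv ℤ_[q] (ballMatrix a n)).toAlgHom

theorem mem_ballOrder {a : ℚ_[q]} {n : ℤ} {X : Matrix (Fin 2) (Fin 2) ℚ_[q]} :
    X ∈ ballOrder a n ↔ X 0 0 - a * X 1 0 ∈ fracIdeal q 0 ∧ X 1 1 + a * X 1 0 ∈ fracIdeal q 0 ∧
      X 1 0 ∈ fracIdeal q (-n) ∧ X 0 1 + (X 0 0 - X 1 1) * a - X 1 0 * a ^ 2 ∈ fracIdeal q n := by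
  have hq := zpow_ne_zero n (cast_prime_ne_zero q)
  rw [ballOrder, mem_map_conjEquiv]
  have h00 : ((ballMatrix a n)⁻¹.val * X * (ballMatrix a n).val) 0 0 =
      X 0 0 - a * X 1 0 := by
    simp [ballMatrix, Matrix.mul_apply, Fin.sum_univ_two, Matrix.vecMul, dotProduct]
    field_simp
    ring
  have h01 : ((ballMatrix a n)⁻¹.val * X * (ballMatrix a n).val) 0 1 =
      (q : ℚ_[q]) ^ (-n) * (X 0 1 + (X 0 0 - X 1 1) * a - X 1 0 * a ^ 2) := by
    simp [ballMatrix, Matrix.mul_apply, Fin.sum_univ_two, Matrix.vecMul, dotProduct]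
    field_simp
    ring
  have h10 : ((ballMatrix a n)⁻¹.val * X * (ballMatrix a n).val) 1 0 =
      (q : ℚ_[q]) ^ n * X 1 0 := by
    simp [ballMatrix, Matrix.mul_apply, Fin.sum_univ_two, Matrix.vecMul, dotProduct]; ring
  have h11 : ((ballMatrix a n)⁻¹.val * X * (ballMatrix a n).val) 1 1 =
      X 1 1 + a * X 1 0 := by
    simp [ballMatrix, Matrix.mul_apply, Fin.sum_univ_two, Matrix.vecMul, dotProduct]; ring
  change (∀ i j, _) ↔ _
  simp only [Fin.forall_fin_two, h00, h01, h10, h11, zpow_mul_mem_fracIdeal, zero_sub,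
    sub_neg_eq_add, zero_add]
  tauto

/-! ### The lattices spanned by `1`, `q ^ c e₀₀`, `e₁₀`, `q ^ d e₀₁` -/

/-- A `ℤ_q`-basis of the lattice of all `X ∈ M_2(ℤ_q)` with `X₀₁ ∈ q ^ d ℤ_q` and
`X₀₀ - X₁₁ ∈ q ^ c ℤ_q`. For `2 c ≤ d` this lattice is the intersection of the maximal orders at the
ends of a tripod: a path of length `d` with a leg of length `c` attached to it, at distance at
least `c` from both ends of the path. -/
noncomputable def tripodVec (q : ℕ) [Fact q.Prime] (c d : ℕ) :
    Fin 4 → Matrix (Fin 2) (Fin 2) ℚ_[q] :=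
  ![1, !![(q : ℚ_[q]) ^ c, 0; 0, 0], !![0, 0; 1, 0], !![0, (q : ℚ_[q]) ^ d; 0, 0]]

theorem sum_smul_tripodVec (c d : ℕ) (r : Fin 4 → ℤ_[q]) :
    ∑ i, r i • tripodVec q c d i =
      !![(r 0 + r 1 * (q : ℚ_[q]) ^ c : ℚ_[q]), r 3 * (q : ℚ_[q]) ^ d; r 2, r 0] := by
  have hs (r : ℤ_[q]) (x : ℚ_[q]) : r • x = r * x := rfl
  ext i j
  fin_cases i <;> fin_cases j <;>
    simp [Fin.sum_univ_four, tripodVec, Matrix.add_apply, hs]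

theorem mem_span_tripodVec {c d : ℕ} {X : Matrix (Fin 2) (Fin 2) ℚ_[q]} :
    X ∈ Submodule.span ℤ_[q] (Set.range (tripodVec q c d)) ↔
      X 1 1 ∈ fracIdeal q 0 ∧ X 1 0 ∈ fracIdeal q 0 ∧ X 0 1 ∈ fracIdeal q d ∧
        X 0 0 - X 1 1 ∈ fracIdeal q c := by
  rw [Submodule.mem_span_range_iff_exists_fun]
  simp only [sum_smul_tripodVec, mem_fracIdeal_iff_exists_zpow (n := (c : ℤ)),
    mem_fracIdeal_iff_exists_zpow (n := (d : ℤ)), mem_fracIdeal_zero_iff, zpow_natCast]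
  constructor
  · rintro ⟨r, rfl⟩
    exact ⟨⟨r 0, by simp⟩, ⟨r 2, by simp⟩, ⟨r 3, by simp⟩, ⟨r 1, by simp⟩⟩
  · rintro ⟨⟨r0, h0⟩, ⟨r2, h2⟩, ⟨r3, h3⟩, ⟨r1, h1⟩⟩
    refine ⟨![r0, r1, r2, r3], ?_⟩
    ext i j
    fin_cases i <;> fin_cases j <;> simp [← h0, ← h2, ← h1, h3]

theorem linearIndependent_tripodVec (c d : ℕ) : LinearIndependent ℤ_[q] (tripodVec q c d) := by
  rw [Fintype.linearIndependent_iff]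
  intro r hr
  have hq := cast_prime_ne_zero q
  rw [sum_smul_tripodVec] at hr
  have h0 := congrFun (congrFun hr 1) 1
  have h1 := congrFun (congrFun hr 0) 0
  have h2 := congrFun (congrFun hr 1) 0
  have h3 := congrFun (congrFun hr 0) 1
  simp [hq] at h0 h1 h2 h3
  simp [h0, hq] at h1
  intro i
  fin_cases i <;> simp_all

theorem span_field_tripodVec (c d : ℕ) :
    Submodule.span ℚ_[q] (Set.range (tripodVec q c d)) = ⊤ := by
  rw [eq_top_iff]
  intro X _
  have hq := cast_prime_ne_zero q
  rw [Submodule.mem_span_range_iff_exists_fun]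
  refine ⟨![X 1 1, (X 0 0 - X 1 1) / (q : ℚ_[q]) ^ c, X 1 0, X 0 1 / (q : ℚ_[q]) ^ d], ?_⟩
  ext i j
  fin_cases i <;> fin_cases j <;> simp [Fin.sum_univ_four, tripodVec, Matrix.add_apply, hq]

theorem isLocalOrder_of_span_tripodVec {Λ : Subalgebra ℤ_[q] (Matrix (Fin 2) (Fin 2) ℚ_[q])}
    {c d : ℕ} (h : Subalgebra.toSubmodule Λ = Submodule.span ℤ_[q] (Set.range (tripodVec q c d))) :
    IsLocalOrder q Λ := by
  constructor
  · rw [h]; exact Submodule.fg_span (Set.finite_range _)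
  · rw [h, Submodule.span_span_of_tower, span_field_tripodVec]

theorem isLocalOrder_integralOrder : IsLocalOrder q (integralOrder q) := by
  refine isLocalOrder_of_span_tripodVec (c := 0) (d := 0) ?_
  ext X
  rw [mem_span_tripodVec]
  change (∀ i j, _) ↔ _
  simp only [Fin.forall_fin_two, Nat.cast_zero]
  constructor
  · rintro ⟨⟨h00, h01⟩, h10, h11⟩
    exact ⟨h11, h10, h01, sub_mem h00 h11⟩
  · rintro ⟨h11, h10, h01, h⟩
    exact ⟨⟨by simpa using add_mem h h11, h01⟩, h10, h11⟩

/-! ### Every vertex of the tree is the order of a ball -/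

theorem IsLocalOrder.exists_forall_mem_fracIdeal
    {Λ : Subalgebra ℤ_[q] (Matrix (Fin 2) (Fin 2) ℚ_[q])} (h : IsLocalOrder q Λ) :
    ∃ N : ℤ, ∀ X ∈ Λ, ∀ i j, X i j ∈ fracIdeal q N := by
  obtain ⟨s, hs⟩ := h.fg
  obtain ⟨N, hN⟩ := ((s ×ˢ (Finset.univ : Finset (Fin 2 × Fin 2))).finite_toSet.image
    fun p => (p.1 p.2.1 p.2.2).valuation).bddBelow
  refine ⟨N, fun X hX => ?_⟩
  rw [← Subalgebra.mem_toSubmodule, ← hs] at hX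
  induction hX using Submodule.span_induction with
  | mem X hX =>
    exact fun i j => fracIdeal_mono (hN ⟨(X, i, j), by simpa using hX, rfl⟩)
      (mem_fracIdeal_valuation _)
  | zero => exact fun i j => Submodule.zero_mem _
  | add X Y _ _ hX hY => exact fun i j => Submodule.add_mem _ (hX i j) (hY i j)
  | smul c X _ hX => exact fun i j => Submodule.smul_mem _ c (hX i j)

/-- An order stabilises the lattice `L` of first columns of its elements. In Hermite normal form `L`
has a basis `(q ^ t, 0)`, `(α, q ^ s)` up to units, and the stabiliser of `L` is the order of the
ball `α / q ^ s + q ^ (t - s) ℤ_q`. -/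
theorem IsLocalOrder.exists_le_ballOrder
    {Λ : Subalgebra ℤ_[q] (Matrix (Fin 2) (Fin 2) ℚ_[q])} (h : IsLocalOrder q Λ) :
    ∃ a n, Λ ≤ ballOrder a n := by
  obtain ⟨N, hN⟩ := h.exists_forall_mem_fracIdeal
  have hne : ∃ X ∈ Λ, X 1 0 ≠ 0 := by
    by_contra! hcon
    have h1 : Submodule.span ℚ_[q] ((Subalgebra.toSubmodule Λ : Set _)) ≤
        LinearMap.ker (Matrix.entryLinearMap ℚ_[q] ℚ_[q] (1 : Fin 2) (0 : Fin 2)) :=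
      Submodule.span_le.2 fun X hX => hcon X hX
    rw [h.span_eq_top] at h1
    have h2 := h1 (Submodule.mem_top (x := !![0, 0; 1, 0]))
    simp at h2
  obtain ⟨s, ⟨P, hP, hP0, hPs⟩, hs⟩ := Int.exists_least_of_bdd
    (P := fun z => ∃ X ∈ Λ, X 1 0 ≠ 0 ∧ (X 1 0).valuation = z)
    ⟨N, by
      rintro z ⟨X, hX, h0, rfl⟩
      exact (mem_fracIdeal_iff_le_valuation h0).1 (hN X hX 1 0)⟩
    (let ⟨X, hX, h0⟩ := hne; ⟨_, X, hX, h0, rfl⟩)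
  obtain ⟨t, ⟨Q, hQ, hQ1, hQ0, hQt⟩, ht⟩ := Int.exists_least_of_bdd
    (P := fun z => ∃ X ∈ Λ, X 1 0 = 0 ∧ X 0 0 ≠ 0 ∧ (X 0 0).valuation = z)
    ⟨N, by
      rintro z ⟨X, hX, -, h0, rfl⟩
      exact (mem_fracIdeal_iff_le_valuation h0).1 (hN X hX 0 0)⟩
    ⟨_, 1, one_mem _, by simp, by simp, rfl⟩
  have hs' : ∀ X ∈ Λ, X 1 0 ∈ fracIdeal q s := fun X hX => by
    by_cases h0 : X 1 0 = 0
    · rw [h0]; exact zero_mem _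
    · exact (mem_fracIdeal_iff_le_valuation h0).2 (hs _ ⟨X, hX, h0, rfl⟩)
  -- Subtracting a multiple of `P` clears the lower entry of the first column.
  have ht' : ∀ X ∈ Λ, X 0 0 - X 1 0 * (P 1 0)⁻¹ * P 0 0 ∈ fracIdeal q t := fun X hX => by
    obtain ⟨c, hc⟩ := mem_fracIdeal_zero_iff.1 (mul_mem_fracIdeal (k := 0) (hs' X hX)
      (inv_mem_fracIdeal (x := P 1 0)) (by omega))
    have hY : X - c • P ∈ Λ := sub_mem hX (Subalgebra.smul_mem _ hP c)
    have e (i j) : (X - c • P) i j = X i j - X 1 0 * (P 1 0)⁻¹ * P i j := by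
      rw [← hc]; rfl
    rw [← e]
    by_cases h0 : (X - c • P) 0 0 = 0
    · rw [h0]; exact zero_mem _
    · refine (mem_fracIdeal_iff_le_valuation h0).2 (ht _ ⟨_, hY, ?_, h0, rfl⟩)
      rw [e]; field_simp; ring
  have hQi := inv_mem_fracIdeal (x := Q 0 0)
  have hPi := inv_mem_fracIdeal (x := P 1 0)
  rw [hQt] at hQi
  rw [hPs] at hPi
  refine ⟨P 0 0 * (P 1 0)⁻¹, t - s, fun X hX => mem_ballOrder.2 ?_⟩
  have hXQ := mul_mem hX hQ
  have hXP := mul_mem hX hP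
  have q1 := hs' _ hXQ
  have q0 := ht' _ hXQ
  have p1 := hs' _ hXP
  have p0 := ht' _ hXP
  simp only [Matrix.mul_apply, Fin.sum_univ_two, hQ1, mul_zero, add_zero] at q0 q1 p0 p1
  refine ⟨?_, ?_, ?_, ?_⟩
  · convert mul_mem_fracIdeal (k := 0) q0 hQi (by omega) using 1
    field_simp
  · convert mul_mem_fracIdeal (k := 0) p1 hPi (by omega) using 1
    field_simp
    ring
  · convert mul_mem_fracIdeal (k := -(t - s)) q1 hQi (by omega) using 1
    field_simp
  · convert mul_mem_fracIdeal (k := t - s) p0 hPi (by omega) using 1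
    field_simp
    ring

theorem mem_integralOrder {X : Matrix (Fin 2) (Fin 2) ℚ_[q]} :
    X ∈ integralOrder q ↔ ∀ i j, X i j ∈ fracIdeal q 0 := Iff.rfl

/-- An order above `M_2(ℤ_q)` lies in the order of some ball; testing the matrix units shows that
this ball is `ℤ_q`. -/
theorem maximal_integralOrder : Maximal (IsLocalOrder q) (integralOrder q) := by
  refine ⟨isLocalOrder_integralOrder, fun Λ hΛ hle => ?_⟩
  obtain ⟨b, m, hb⟩ := hΛ.exists_le_ballOrder
  have key (X : Matrix (Fin 2) (Fin 2) ℚ_[q]) (hX : ∀ i j, X i j ∈ fracIdeal q 0) :=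
    mem_ballOrder.1 (hb (hle hX))
  have h1 := one_mem_fracIdeal_zero (q := q)
  have h10 := key !![0, 0; 1, 0] (by simp [Fin.forall_fin_two, h1])
  have h01 := key !![0, 1; 0, 0] (by simp [Fin.forall_fin_two, h1])
  simp at h10 h01
  have hm1 := zpow_mem_fracIdeal (q := q).1 (by simpa using h10.2.1 : (q : ℚ_[q]) ^ (0 : ℤ) ∈ _)
  have hm2 := zpow_mem_fracIdeal (q := q).1 (by simpa using h01 : (q : ℚ_[q]) ^ (0 : ℤ) ∈ _)
  obtain rfl : m = 0 := by omega
  have hb0 : b ∈ fracIdeal q 0 := h10.1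
  intro X hX
  obtain ⟨hx, hw, hz, hy⟩ := mem_ballOrder.1 (hb hX)
  rw [neg_zero] at hz
  have hbz := mul_mem_fracIdeal (k := 0) hb0 hz (by simp)
  have h00 : X 0 0 ∈ fracIdeal q 0 := by simpa using add_mem hx hbz
  have h11 : X 1 1 ∈ fracIdeal q 0 := by simpa using sub_mem hw hbz
  have h01 : X 0 1 ∈ fracIdeal q 0 := by
    convert add_mem (sub_mem hy (mul_mem_fracIdeal (k := 0) (sub_mem h00 h11) hb0 (by simp)))
      (mul_mem_fracIdeal (k := 0) hbz hb0 (by simp)) using 1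
    ring
  rw [mem_integralOrder]
  simp only [Fin.forall_fin_two]
  exact ⟨⟨h00, h01⟩, hz, h11⟩

/-- The vertex of the tree attached to the ball `a + q ^ n ℤ_q`. -/
noncomputable def ballVertex (a : ℚ_[q]) (n : ℤ) : MaxOrder q :=
  MaxOrder.conj (ballMatrix a n) ⟨integralOrder q, maximal_integralOrder⟩

theorem coe_ballVertex (a : ℚ_[q]) (n : ℤ) : (ballVertex a n).1 = ballOrder a n := rfl

theorem exists_eq_ballVertex (Λ : MaxOrder q) : ∃ a n, Λ = ballVertex a n := by
  obtain ⟨a, n, h⟩ := Λ.2.1.exists_le_ballOrder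
  exact ⟨a, n, MaxOrder.eq_of_le h⟩

/-! ### The action of affine maps and of the inversion on balls -/

theorem conj_ballMatrix_ballVertex (c : ℚ_[q]) (s : ℤ) (a : ℚ_[q]) (n : ℤ) :
    (ballVertex a n).conj (ballMatrix c s) = ballVertex ((q : ℚ_[q]) ^ s * a + c) (s + n) := by
  rw [ballVertex, ← MaxOrder.conj_mul, ballVertex]
  congr 1
  ext i j
  fin_cases i <;> fin_cases j <;>
    simp [ballMatrix, zpow_add₀ (cast_prime_ne_zero q)]

theorem ballVertex_congr {a b : ℚ_[q]} {n : ℤ} (h : a - b ∈ fracIdeal q n) :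
    ballVertex a n = ballVertex b n := by
  refine MaxOrder.eq_of_le fun X hX => ?_
  rw [coe_ballVertex, mem_ballOrder] at *
  obtain ⟨hx, hw, hz, hy⟩ := hX
  have hez := mul_mem_fracIdeal (k := 0) h hz (by simp)
  refine ⟨?_, ?_, hz, ?_⟩
  · convert add_mem hx hez using 1; ring
  · convert sub_mem hw hez using 1; ring
  · convert sub_mem (sub_mem hy (mul_mem_fracIdeal (k := n) h (sub_mem hx hw) (by simp)))
      (mul_mem_fracIdeal (k := n) hez h (by simp)) using 1
    ring

/-- The matrix of the inversion `x ↦ x⁻¹` of the projective line. -/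
noncomputable def swapMatrix (q : ℕ) [Fact q.Prime] : (Matrix (Fin 2) (Fin 2) ℚ_[q])ˣ where
  val := !![0, 1; 1, 0]
  inv := !![0, 1; 1, 0]
  val_inv := by simp [Matrix.one_fin_two]
  inv_val := by simp [Matrix.one_fin_two]

theorem mem_conj_swapMatrix {Λ : MaxOrder q} {X : Matrix (Fin 2) (Fin 2) ℚ_[q]} :
    X ∈ (Λ.conj (swapMatrix q)).1 ↔ !![X 1 1, X 1 0; X 0 1, X 0 0] ∈ Λ.1 := by
  rw [MaxOrder.coe_conj, mem_map_conjEquiv]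
  have : (swapMatrix q)⁻¹.val * X * (swapMatrix q).val = !![X 1 1, X 1 0; X 0 1, X 0 0] := by
    rw [Matrix.eta_fin_two X]
    simp [swapMatrix]
  rw [this]

theorem conj_swapMatrix_ballVertex_zero (n : ℤ) :
    (ballVertex 0 n : MaxOrder q).conj (swapMatrix q) = ballVertex 0 (-n) := by
  refine MaxOrder.eq_of_le fun X hX => ?_
  rw [mem_conj_swapMatrix, coe_ballVertex, mem_ballOrder] at hX
  rw [coe_ballVertex, mem_ballOrder]
  simp at hX ⊢
  tauto

/-- The inversion carries a ball which avoids `0` to a ball. -/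
theorem conj_swapMatrix_ballVertex {b : ℚ_[q]} (hb : b ≠ 0) {m : ℤ} (hm : b.valuation < m) :
    (ballVertex b m).conj (swapMatrix q) = ballVertex b⁻¹ (m - 2 * b.valuation) := by
  refine MaxOrder.eq_of_le fun X hX => ?_
  rw [mem_conj_swapMatrix, coe_ballVertex, mem_ballOrder] at hX
  rw [coe_ballVertex, mem_ballOrder]
  simp at hX ⊢
  obtain ⟨hx, hw, hz, hy⟩ := hX
  have hb1 := mem_fracIdeal_valuation b
  have hb2 := inv_mem_fracIdeal (x := b)
  have hyb := mul_mem_fracIdeal (k := 0) hy hb2 (by omega)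
  refine ⟨?_, ?_, ?_, ?_⟩
  · convert sub_mem hx hyb using 1
    field_simp
    ring
  · convert add_mem hw hyb using 1
    field_simp
    ring
  · convert sub_mem (fracIdeal_mono (m := 2 * b.valuation - m) (by omega) hy)
      (add_mem (mul_mem_fracIdeal (k := 2 * b.valuation - m) (sub_mem hx hw) hb1 (by omega))
      (mul_mem_fracIdeal (k := 2 * b.valuation - m)
        (mul_mem_fracIdeal (k := b.valuation - m) hz hb1 (by omega)) hb1 (by omega))) using 1
    ring
  · convert neg_mem (mul_mem_fracIdeal (k := m - 2 * b.valuation)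
      (mul_mem_fracIdeal (k := m - b.valuation) hy hb2 (by omega)) hb2 (by omega)) using 1
    field_simp
    ring

/-- The level `k` of the smallest ball `a + q ^ k ℤ_q` that contains both `a + q ^ n ℤ_q` and
`b + q ^ m ℤ_q`. It is `min n m` for `a = b`, where the junk value `valuation 0 = 0` must not
enter. -/
noncomputable def ballMeet (a : ℚ_[q]) (n : ℤ) (b : ℚ_[q]) (m : ℤ) : ℤ :=
  open Classical in if a = b then min n m else min (min n m) (a - b).valuation

theorem le_ballMeet_iff {a b : ℚ_[q]} {n m k : ℤ} :
    k ≤ ballMeet a n b m ↔ k ≤ n ∧ k ≤ m ∧ a - b ∈ fracIdeal q k := by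
  unfold ballMeet
  split_ifs with h
  · simp [h]
  · rw [mem_fracIdeal_iff_le_valuation (sub_ne_zero.2 h), le_min_iff, le_min_iff, and_assoc]

theorem ballMeet_zero_eq_min (n : ℤ) (b : ℚ_[q]) (m : ℤ) :
    ballMeet 0 n b m = min n (ballMeet 0 m b m) := by
  refine eq_of_forall_le_iff fun k => ?_
  rw [le_min_iff, le_ballMeet_iff, le_ballMeet_iff]
  tauto

theorem ballMeet_sub_zpow_mul (a : ℚ_[q]) (n : ℤ) (b : ℚ_[q]) (m : ℤ) :
    ballMeet 0 0 ((q : ℚ_[q]) ^ (-n) * (b - a)) (m - n) = ballMeet a n b m - n := by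
  refine eq_of_forall_le_iff fun k => ?_
  rw [le_sub_iff_add_le, le_ballMeet_iff, le_ballMeet_iff, zero_sub, neg_mem_iff,
    zpow_mul_mem_fracIdeal, ← neg_mem_iff, neg_sub, sub_neg_eq_add]
  refine and_congr (by omega) (and_congr (by omega) Iff.rfl)

/-! ### Normal form of a pair of vertices -/

/-- One of three moves brings the second ball to a ball around `0`: a translation if it lies in
`ℤ_q`, the inversion if it contains `ℤ_q`, and the inversion followed by a translation if the two
are disjoint. -/
theorem exists_conj_ballVertex_of_zero (b : ℚ_[q]) (m : ℤ) :
    ∃ g, (ballVertex 0 0 : MaxOrder q).conj g = ballVertex 0 0 ∧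
      (ballVertex b m).conj g = ballVertex 0 (m - 2 * ballMeet 0 0 b m) := by
  obtain ⟨h1, h2, h3⟩ := le_ballMeet_iff.1 (le_refl (ballMeet 0 0 b m))
  rw [zero_sub, neg_mem_iff] at h3
  -- A translation by an integral element fixes the vertex of `ℤ_q`.
  have htrans {c : ℚ_[q]} (hc : c ∈ fracIdeal q 0) (n : ℤ) :
      (ballVertex 0 0 : MaxOrder q).conj (ballMatrix (-c) 0) = ballVertex 0 0 ∧
        (ballVertex c n).conj (ballMatrix (-c) 0) = ballVertex 0 n := by
    rw [conj_ballMatrix_ballVertex, conj_ballMatrix_ballVertex]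
    exact ⟨by simpa using ballVertex_congr (by simpa using hc), by simp⟩
  have hswap : (ballVertex 0 0 : MaxOrder q).conj (swapMatrix q) = ballVertex 0 0 := by
    simpa using conj_swapMatrix_ballVertex_zero (q := q) 0
  generalize hk : ballMeet 0 0 b m = k at *
  by_cases hk0 : k = 0
  · subst hk0
    obtain ⟨e1, e2⟩ := htrans h3 m
    exact ⟨_, e1, by simpa using e2⟩
  by_cases hkm : k = m
  · subst hkm
    refine ⟨swapMatrix q, hswap, ?_⟩
    rw [ballVertex_congr (b := 0) (by simpa using h3), conj_swapMatrix_ballVertex_zero]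
    congr 1
    ring
  have hb : b ≠ 0 := by
    rintro rfl
    simp [ballMeet] at hk
    omega
  have hv : b.valuation = k := by
    simp [ballMeet, hb.symm] at hk
    have : (-b).valuation = b.valuation := by
      refine eq_of_forall_le_iff fun j => ?_
      rw [← mem_fracIdeal_iff_le_valuation hb, ← mem_fracIdeal_iff_le_valuation (neg_ne_zero.2 hb),
        neg_mem_iff]
    omega
  have hb' : b⁻¹ ∈ fracIdeal q 0 := fracIdeal_mono (by omega) inv_mem_fracIdeal
  obtain ⟨e1, e2⟩ := htrans hb' (m - 2 * k)
  refine ⟨ballMatrix (-b⁻¹) 0 * swapMatrix q, ?_, ?_⟩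
  · rw [MaxOrder.conj_mul, hswap, e1]
  · rw [MaxOrder.conj_mul, conj_swapMatrix_ballVertex hb (by omega), hv, e2]

/-- The group acts on pairs of vertices with the integer `n + m - 2 k` as invariant, where `k` is
the level of the smallest ball containing both balls: every pair can be moved to the balls `ℤ_q`
and `q ^ (n + m - 2 k) ℤ_q`. -/
theorem exists_conj_ballVertex (a : ℚ_[q]) (n : ℤ) (b : ℚ_[q]) (m : ℤ) :
    ∃ g, (ballVertex a n).conj g = ballVertex 0 0 ∧
      (ballVertex b m).conj g = ballVertex 0 (n + m - 2 * ballMeet a n b m) := by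
  have hq := cast_prime_ne_zero q
  obtain ⟨g, h1, h2⟩ := exists_conj_ballVertex_of_zero ((q : ℚ_[q]) ^ (-n) * (b - a)) (m - n)
  refine ⟨g * ballMatrix (-((q : ℚ_[q]) ^ (-n) * a)) (-n), ?_, ?_⟩
  · rw [MaxOrder.conj_mul, conj_ballMatrix_ballVertex]
    simpa using h1
  · rw [MaxOrder.conj_mul, conj_ballMatrix_ballVertex, ← sub_eq_add_neg, ← mul_sub,
      neg_add_eq_sub, h2, ballMeet_sub_zpow_mul]
    congr 1
    ring

theorem exists_conj_eq_ballVertex (Λ Λ' : MaxOrder q) :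
    ∃ (g : (Matrix (Fin 2) (Fin 2) ℚ_[q])ˣ) (D : ℕ),
      Λ.conj g = ballVertex 0 0 ∧ Λ'.conj g = ballVertex 0 D := by
  obtain ⟨a, n, rfl⟩ := exists_eq_ballVertex Λ
  obtain ⟨b, m, rfl⟩ := exists_eq_ballVertex Λ'
  obtain ⟨g, h1, h2⟩ := exists_conj_ballVertex a n b m
  obtain ⟨h3, h4, -⟩ := le_ballMeet_iff.1 (le_refl (ballMeet a n b m))
  refine ⟨g, (n + m - 2 * ballMeet a n b m).toNat, h1, ?_⟩
  rw [h2, Int.toNat_of_nonneg (by omega)]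

/-! ### Distances in the tree -/

theorem mem_ballOrder_zero {n : ℤ} {X : Matrix (Fin 2) (Fin 2) ℚ_[q]} :
    X ∈ ballOrder 0 n ↔ X 0 0 ∈ fracIdeal q 0 ∧ X 1 1 ∈ fracIdeal q 0 ∧
      X 1 0 ∈ fracIdeal q (-n) ∧ X 0 1 ∈ fracIdeal q n := by
  simp [mem_ballOrder]

/-- The upper right entry maps `M_2(ℤ_q)` onto `ℤ_q`, and the intersection is the preimage of
`q ^ D ℤ_q`. -/
theorem orderIndex_ballVertex_zero (D : ℕ) :
    orderIndex (ballVertex 0 0 : MaxOrder q).1 (ballVertex 0 D).1 = q ^ D := by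
  let f := (Matrix.entryAddMonoidHom ℚ_[q] (0 : Fin 2) (1 : Fin 2))
  have h1 : (Subalgebra.toSubmodule ((ballVertex 0 0 : MaxOrder q).1 ⊓
      (ballVertex 0 D).1)).toAddSubgroup = (fracIdeal q D).toAddSubgroup.comap f ⊓
      (Subalgebra.toSubmodule (ballVertex 0 0 : MaxOrder q).1).toAddSubgroup := by
    ext X
    change X ∈ ballOrder 0 0 ∧ X ∈ ballOrder 0 (D : ℤ) ↔
      X 0 1 ∈ fracIdeal q D ∧ X ∈ ballOrder 0 0
    rw [mem_ballOrder_zero, mem_ballOrder_zero]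
    constructor
    · tauto
    · rintro ⟨h, h0, h1, h2, h3⟩
      exact ⟨⟨h0, h1, h2, h3⟩, h0, h1, fracIdeal_mono (by omega) h2, h⟩
  have h2 : (Subalgebra.toSubmodule (ballVertex 0 0 : MaxOrder q).1).toAddSubgroup.map f =
      (fracIdeal q 0).toAddSubgroup := by
    ext x
    constructor
    · rintro ⟨X, hX, rfl⟩
      exact (mem_ballOrder_zero.1 hX).2.2.2
    · intro hx
      exact ⟨!![0, x; 0, 0], mem_ballOrder_zero.2 (by simpa using hx), rfl⟩
  rw [orderIndex, h1, AddSubgroup.inf_relIndex_right, AddSubgroup.relIndex_comap, h2,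
    relIndex_fracIdeal]

theorem orderIndex_ballVertex_zero_symm (D : ℕ) :
    orderIndex (ballVertex 0 D : MaxOrder q).1 (ballVertex 0 0).1 = q ^ D := by
  rw [← orderIndex_ballVertex_zero, ← MaxOrder.orderIndex_conj (ballMatrix 0 D * swapMatrix q)]
  simp only [MaxOrder.conj_mul, conj_swapMatrix_ballVertex_zero, conj_ballMatrix_ballVertex]
  simp

theorem orderIndex_ne_zero (Λ Λ' : MaxOrder q) : orderIndex Λ.1 Λ'.1 ≠ 0 := by
  obtain ⟨g, D, h1, h2⟩ := exists_conj_eq_ballVertex Λ Λ'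
  rw [← MaxOrder.orderIndex_conj g, h1, h2, orderIndex_ballVertex_zero]
  exact pow_ne_zero _ (Fact.out : q.Prime).ne_zero

theorem orderIndex_le_mul (Λ₁ Λ₂ Λ₃ : MaxOrder q) :
    orderIndex Λ₁.1 Λ₃.1 ≤ orderIndex Λ₁.1 Λ₂.1 * orderIndex Λ₂.1 Λ₃.1 := by
  have key (M N : MaxOrder q) : orderIndex M.1 N.1 =
      (Subalgebra.toSubmodule N.1).toAddSubgroup.relIndex
        (Subalgebra.toSubmodule M.1).toAddSubgroup := by
    rw [← AddSubgroup.inf_relIndex_left]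
    rfl
  have h12 := orderIndex_ne_zero Λ₁ Λ₂
  have h23 := orderIndex_ne_zero Λ₂ Λ₃
  rw [key] at h12 h23
  rw [key, key, key]
  generalize (Subalgebra.toSubmodule Λ₁.1).toAddSubgroup = A at *
  generalize (Subalgebra.toSubmodule Λ₂.1).toAddSubgroup = B at *
  generalize (Subalgebra.toSubmodule Λ₃.1).toAddSubgroup = C at *
  have h := AddSubgroup.relIndex_inf_mul_relIndex C B A
  have hle : C.relIndex (B ⊓ A) ≤ C.relIndex B :=
    AddSubgroup.relIndex_le_of_le_right inf_le_left h23
  have hne : C.relIndex (B ⊓ A) ≠ 0 := fun h0 =>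
    h23 (AddSubgroup.relIndex_eq_zero_of_le_right inf_le_left h0)
  calc C.relIndex A ≤ (C ⊓ B).relIndex A :=
        AddSubgroup.relIndex_le_of_le_left inf_le_left (h ▸ mul_ne_zero hne h12)
    _ = B.relIndex A * C.relIndex (B ⊓ A) := by rw [← h, mul_comm]
    _ ≤ _ := Nat.mul_le_mul_left _ hle

theorem orderIndex_le_pow_length {Λ Λ' : MaxOrder q} (p : (bruhatTitsTree q).Walk Λ Λ') :
    orderIndex Λ.1 Λ'.1 ≤ q ^ p.length := by
  induction p with
  | nil => simp [orderIndex]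
  | @cons _ v _ h p ih =>
    refine (orderIndex_le_mul _ v _).trans ?_
    rw [SimpleGraph.Walk.length_cons, pow_succ', h.1]
    exact Nat.mul_le_mul_left _ ih

theorem exists_walk_ballVertex (g : (Matrix (Fin 2) (Fin 2) ℚ_[q])ˣ) (D : ℕ) :
    ∃ p : (bruhatTitsTree q).Walk ((ballVertex 0 0).conj g) ((ballVertex 0 D).conj g),
      p.length = D := by
  induction D with
  | zero => exact ⟨SimpleGraph.Walk.nil, rfl⟩
  | succ D ih =>
    obtain ⟨p, hp⟩ := ih
    have e0 : (ballVertex 0 D : MaxOrder q) = (ballVertex 0 (0 : ℕ)).conj (ballMatrix 0 D) := by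
      rw [conj_ballMatrix_ballVertex]; simp
    have e1 : (ballVertex 0 (D + 1 : ℕ) : MaxOrder q) =
        (ballVertex 0 (1 : ℕ)).conj (ballMatrix 0 D) := by
      rw [conj_ballMatrix_ballVertex]; simp
    have hadj : (bruhatTitsTree q).Adj ((ballVertex 0 D).conj g)
        ((ballVertex 0 (D + 1 : ℕ)).conj g) := by
      constructor
      · rw [MaxOrder.orderIndex_conj, e0, e1, MaxOrder.orderIndex_conj, Nat.cast_zero,
          orderIndex_ballVertex_zero, pow_one]
      · rw [MaxOrder.orderIndex_conj, e0, e1, MaxOrder.orderIndex_conj, Nat.cast_zero,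
          orderIndex_ballVertex_zero_symm, pow_one]
    exact ⟨p.concat hadj, by rw [SimpleGraph.Walk.length_concat, hp]⟩

/-- The distance is computed by the index: a path of length `D` is explicit, and no shorter one
exists because the index is submultiplicative along paths. -/
theorem dist_eq_of_conj {g : (Matrix (Fin 2) (Fin 2) ℚ_[q])ˣ} {Λ Λ' : MaxOrder q} {D : ℕ}
    (h : Λ.conj g = ballVertex 0 0) (h' : Λ'.conj g = ballVertex 0 D) :
    (bruhatTitsTree q).dist Λ Λ' = D := by
  have hΛ : Λ = (ballVertex 0 0).conj g⁻¹ := by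
    rw [← h, ← MaxOrder.conj_mul, inv_mul_cancel, MaxOrder.conj_one]
  have hΛ' : Λ' = (ballVertex 0 D).conj g⁻¹ := by
    rw [← h', ← MaxOrder.conj_mul, inv_mul_cancel, MaxOrder.conj_one]
  have hindex : orderIndex Λ.1 Λ'.1 = q ^ D := by
    rw [← MaxOrder.orderIndex_conj g, h, h', orderIndex_ballVertex_zero]
  obtain ⟨p, hp⟩ : ∃ p : (bruhatTitsTree q).Walk Λ Λ', p.length = D := by
    rw [hΛ, hΛ']
    exact exists_walk_ballVertex g⁻¹ D
  obtain ⟨p', hp'⟩ := p.reachable.exists_walk_length_eq_dist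
  refine le_antisymm (hp ▸ SimpleGraph.dist_le p) ?_
  have := orderIndex_le_pow_length p'
  rw [hindex, hp'] at this
  exact (Nat.pow_le_pow_iff_right (Fact.out : q.Prime).one_lt).1 this

theorem dist_conj (g : (Matrix (Fin 2) (Fin 2) ℚ_[q])ˣ) (Λ Λ' : MaxOrder q) :
    (bruhatTitsTree q).dist (Λ.conj g) (Λ'.conj g) = (bruhatTitsTree q).dist Λ Λ' := by
  obtain ⟨h, D, h1, h2⟩ := exists_conj_eq_ballVertex Λ Λ'
  rw [dist_eq_of_conj h1 h2]
  refine dist_eq_of_conj (g := h * g⁻¹) ?_ ?_ <;>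
    rwa [← MaxOrder.conj_mul, inv_mul_cancel_right]

theorem dist_ballVertex (a : ℚ_[q]) (n : ℤ) (b : ℚ_[q]) (m : ℤ) :
    ((bruhatTitsTree q).dist (ballVertex a n) (ballVertex b m) : ℤ) =
      n + m - 2 * ballMeet a n b m := by
  obtain ⟨g, h1, h2⟩ := exists_conj_ballVertex a n b m
  obtain ⟨h3, h4, -⟩ := le_ballMeet_iff.1 (le_refl (ballMeet a n b m))
  rw [← Int.toNat_of_nonneg (show 0 ≤ n + m - 2 * ballMeet a n b m by omega)] at h2 ⊢
  rw [dist_eq_of_conj h1 h2]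

/-! ### Discriminants -/

/-- The determinant of the trace form changes by the square of a unit under a change of basis. -/
theorem gram_basis_change {Λ : Subalgebra ℤ_[q] (Matrix (Fin 2) (Fin 2) ℚ_[q])}
    (b β : Module.Basis (Fin 4) ℤ_[q] Λ) :
    ∃ u : ℤ_[q]ˣ, (Matrix.of fun i j : Fin 4 =>
        Matrix.trace ((b i : Matrix (Fin 2) (Fin 2) ℚ_[q]) *
          (b j : Matrix (Fin 2) (Fin 2) ℚ_[q]))).det = ((u : ℤ_[q]) : ℚ_[q]) ^ 2 *
      (Matrix.of fun i j : Fin 4 =>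
        Matrix.trace ((β i : Matrix (Fin 2) (Fin 2) ℚ_[q]) *
          (β j : Matrix (Fin 2) (Fin 2) ℚ_[q]))).det := by
  set P := β.toMatrix b with hP
  have hdet : IsUnit P.det := by
    rw [← Matrix.isUnit_iff_isUnit_det]
    exact IsUnit.of_mul_eq_one _ (β.toMatrix_mul_toMatrix_flip b)
  obtain ⟨u, hu⟩ := hdet
  refine ⟨u, ?_⟩
  have hb (i) : (b i : Matrix (Fin 2) (Fin 2) ℚ_[q]) =
      ∑ k, (P k i : ℚ_[q]) • (β k : Matrix (Fin 2) (Fin 2) ℚ_[q]) := by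
    conv_lhs => rw [← β.sum_toMatrix_smul_self b i]
    rw [AddSubmonoidClass.coe_finsetSum]
    rfl
  have hG : (Matrix.of fun i j : Fin 4 =>
        Matrix.trace ((b i : Matrix (Fin 2) (Fin 2) ℚ_[q]) *
          (b j : Matrix (Fin 2) (Fin 2) ℚ_[q]))) =
      (P.map PadicInt.Coe.ringHom).transpose * (Matrix.of fun i j : Fin 4 =>
        Matrix.trace ((β i : Matrix (Fin 2) (Fin 2) ℚ_[q]) *
          (β j : Matrix (Fin 2) (Fin 2) ℚ_[q]))) * P.map PadicInt.Coe.ringHom := by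
    ext i j
    simp only [Matrix.of_apply, hb, Matrix.mul_apply, Finset.sum_mul, Finset.mul_sum,
      Matrix.trace_sum, Matrix.smul_mul, Matrix.mul_smul, Matrix.trace_smul, smul_eq_mul,
      Matrix.transpose_apply, Matrix.map_apply]
    refine Finset.sum_congr rfl fun k _ => Finset.sum_congr rfl fun l _ => ?_
    change (P _ _ : ℚ_[q]) * _ = (P _ _ : ℚ_[q]) * _ * (P _ _ : ℚ_[q])
    ring
  have hPd : (P.map PadicInt.Coe.ringHom).det = ((u : ℤ_[q]) : ℚ_[q]) := by
    rw [hu]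
    exact (RingHom.map_det (PadicInt.Coe.ringHom : ℤ_[q] →+* ℚ_[q]) P).symm
  rw [hG, Matrix.det_mul, Matrix.det_mul, Matrix.det_transpose, hPd]
  ring

theorem det_gram_tripodVec (c d : ℕ) :
    (Matrix.of fun i j => Matrix.trace (tripodVec q c d i * tripodVec q c d j)).det =
      -((q : ℚ_[q]) ^ (c + d)) ^ 2 := by
  have : (Matrix.of fun i j => Matrix.trace (tripodVec q c d i * tripodVec q c d j)) =
      !![2, (q : ℚ_[q]) ^ c, 0, 0; (q : ℚ_[q]) ^ c, (q : ℚ_[q]) ^ (2 * c), 0, 0;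
        0, 0, 0, (q : ℚ_[q]) ^ d; 0, 0, (q : ℚ_[q]) ^ d, 0] := by
    ext i j
    fin_cases i <;> fin_cases j <;>
      simp [tripodVec, Matrix.trace_fin_two, two_mul, pow_add, one_add_one_eq_two]
  rw [this]
  simp [Matrix.det_succ_row_zero, Fin.sum_univ_succ]
  simp [Fin.succAbove, Fin.lt_def]
  ring

/-- An order which is conjugate to the span of `tripodVec q c d` has reduced discriminant
`q ^ (c + d)`, up to units. -/
theorem discriminant_of_map_conj {Λ : Subalgebra ℤ_[q] (Matrix (Fin 2) (Fin 2) ℚ_[q])}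
    {g : (Matrix (Fin 2) (Fin 2) ℚ_[q])ˣ} {c d : ℕ}
    (h : Subalgebra.toSubmodule (Λ.map (conjEquiv ℤ_[q] g).toAlgHom) =
      Submodule.span ℤ_[q] (Set.range (tripodVec q c d))) :
    (∃ Δ : ℤ_[q], IsReducedDiscriminant Λ Δ) ∧
    ∀ Δ : ℤ_[q], IsReducedDiscriminant Λ Δ → Δ ≠ 0 ∧ Δ.valuation = c + d := by
  let e : Λ ≃ₗ[ℤ_[q]] Subalgebra.toSubmodule (Λ.map (conjEquiv ℤ_[q] g).toAlgHom) :=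
    (conjEquiv ℤ_[q] g).toLinearEquiv.submoduleMap (Subalgebra.toSubmodule Λ)
  let β : Module.Basis (Fin 4) ℤ_[q] Λ :=
    ((Module.Basis.span (linearIndependent_tripodVec c d)).map (LinearEquiv.ofEq _ _ h.symm)).map
      e.symm
  have hβ (i) : (g.val * (β i).1 * (g⁻¹).val) = tripodVec q c d i := by
    have h1 : e (β i) = (LinearEquiv.ofEq _ _ h.symm)
        (Module.Basis.span (linearIndependent_tripodVec c d) i) := by simp [β]
    have h2 := congrArg Subtype.val h1
    rw [LinearEquiv.coe_ofEq_apply, Module.Basis.span_apply] at h2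
    exact h2
  have hG : (Matrix.of fun i j : Fin 4 =>
        Matrix.trace ((β i : Matrix (Fin 2) (Fin 2) ℚ_[q]) *
          (β j : Matrix (Fin 2) (Fin 2) ℚ_[q]))).det = -((q : ℚ_[q]) ^ (c + d)) ^ 2 := by
    rw [← det_gram_tripodVec]
    congr 1
    ext i j
    rw [Matrix.of_apply, Matrix.of_apply, ← hβ, ← hβ]
    have : g.val * (β i).1 * g⁻¹.val * (g.val * (β j).1 * g⁻¹.val) =
        g.val * ((β i).1 * (β j).1) * g⁻¹.val := by simp [mul_assoc]
    rw [this, Matrix.trace_units_conj]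
  constructor
  · exact ⟨(q : ℤ_[q]) ^ (c + d), β, -1, by rw [hG]; simp⟩
  · rintro Δ ⟨b, u, hu⟩
    obtain ⟨v, hv⟩ := gram_basis_change b β
    have h1 := congrArg norm hu
    rw [hv, hG] at h1
    simp only [norm_mul, norm_pow, norm_neg] at h1
    have hn (w : ℤ_[q]ˣ) : ‖((w : ℤ_[q]) : ℚ_[q])‖ = 1 := by
      rw [← PadicInt.norm_def]; exact PadicInt.norm_units w
    rw [hn, hn, one_pow, one_mul, one_mul, ← norm_pow (q : ℚ_[q]), ← PadicInt.norm_def] at h1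
    have h2 : ‖Δ‖ = ‖(q : ℚ_[q]) ^ (c + d)‖ :=
      (pow_left_inj₀ (norm_nonneg _) (norm_nonneg _) two_ne_zero).1 h1
    have hΔ : Δ ≠ 0 := by
      rw [← norm_ne_zero_iff, h2]
      exact norm_ne_zero_iff.2 (pow_ne_zero _ (cast_prime_ne_zero q))
    refine ⟨hΔ, ?_⟩
    rw [PadicInt.norm_eq_zpow_neg_valuation hΔ, Padic.norm_p_pow] at h2
    have h3 := zpow_right_injective₀ (by linarith [one_lt_cast_prime q])
      (one_lt_cast_prime q).ne' h2
    omega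

/-! ### Intersections -/

/-- Let the ball `b + q ^ m ℤ_q` hang off the path from `ℤ_q` to `q ^ d ℤ_q` at the ball of level
`i = ballMeet 0 m b m`. If `m - i ≤ i` and `m ≤ d`, then an element of the Eichler order of the path
lies in the order of `b + q ^ m ℤ_q` exactly when its diagonal entries agree modulo `q ^ (m - i)`:
all other terms of the four congruences are integral enough. -/
theorem mem_ballOrder_iff_of_mem {b : ℚ_[q]} {m d : ℤ} {X : Matrix (Fin 2) (Fin 2) ℚ_[q]}
    (hX0 : X ∈ ballOrder 0 0) (hXd : X ∈ ballOrder 0 d)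
    (hi : 0 ≤ ballMeet 0 m b m) (hmi : m ≤ 2 * ballMeet 0 m b m) (hmd : m ≤ d) :
    X ∈ ballOrder b m ↔ X 0 0 - X 1 1 ∈ fracIdeal q (m - ballMeet 0 m b m) := by
  obtain ⟨hx, hw, hz, -⟩ := mem_ballOrder_zero.1 hX0
  obtain ⟨-, -, -, hy⟩ := mem_ballOrder_zero.1 hXd
  rw [neg_zero] at hz
  obtain ⟨him, -, hb⟩ := le_ballMeet_iff.1 (le_refl (ballMeet 0 m b m))
  rw [zero_sub, neg_mem_iff] at hb
  have hbz := mul_mem_fracIdeal (k := ballMeet 0 m b m) hb hz (by omega)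
  have hbz0 := fracIdeal_mono hi hbz
  have hzb := mul_mem_fracIdeal (k := m) hbz hb (by omega)
  have hym := fracIdeal_mono hmd hy
  rw [mem_ballOrder]
  constructor
  · rintro ⟨-, -, -, h⟩
    have h1 : (X 0 0 - X 1 1) * b ∈ fracIdeal q m := by
      convert add_mem (sub_mem h hym) hzb using 1
      ring
    rcases him.eq_or_lt with h2 | h2
    · rw [h2, sub_self]
      exact sub_mem hx hw
    · have hb0 : b ≠ 0 := by
        rintro rfl
        simp [ballMeet] at h2
      have hv : b.valuation ≤ ballMeet 0 m b m := by
        by_contra! hlt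
        have : min m b.valuation ≤ ballMeet 0 m b m := le_ballMeet_iff.2 ⟨min_le_left _ _,
          min_le_left _ _, by
            rw [zero_sub, neg_mem_iff]
            exact fracIdeal_mono (min_le_right _ _) (mem_fracIdeal_valuation b)⟩
        omega
      convert mul_mem_fracIdeal (k := m - ballMeet 0 m b m) h1
        (inv_mem_fracIdeal (x := b)) (by omega) using 1
      field_simp
  · intro h
    refine ⟨sub_mem hx hbz0, add_mem hw hbz0, fracIdeal_mono (by omega) hz, ?_⟩
    convert sub_mem (add_mem hym (mul_mem_fracIdeal (k := m) h hb (by omega))) hzb using 1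
    ring

/-- Let two members of `S` realise its diameter `d`. In coordinates which carry them to the balls
`ℤ_q` and `q ^ d ℤ_q`, every member of `S` hangs off the path between them, at depth `c` say, and
imposes the congruence `X₀₀ ≡ X₁₁` modulo `q ^ c`. The intersection only sees the largest depth. -/
theorem exists_map_iInf_eq_span (S : Finset (MaxOrder q)) (hS : S.Nonempty) :
    ∃ (g : (Matrix (Fin 2) (Fin 2) ℚ_[q])ˣ) (c d : ℕ),
      Subalgebra.toSubmodule ((⨅ Λ ∈ S, Λ.1).map (conjEquiv ℤ_[q] g).toAlgHom) =
        Submodule.span ℤ_[q] (Set.range (tripodVec q c d)) ∧ d3 S = 2 * (c + d) := by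
  obtain ⟨⟨Λ₁, Λ₂⟩, h12, hmax⟩ := (S ×ˢ S).exists_max_image
    (fun p => (bruhatTitsTree q).dist p.1 p.2) (hS.product hS)
  obtain ⟨h1, h2⟩ := Finset.mem_product.1 h12
  replace hmax (Λ) (hΛ : Λ ∈ S) (Λ') (hΛ' : Λ' ∈ S) := hmax (Λ, Λ') (Finset.mk_mem_product hΛ hΛ')
  simp only at h1 h2 hmax
  obtain ⟨g, d, hg1, hg2⟩ := exists_conj_eq_ballVertex Λ₁ Λ₂
  have hd := dist_eq_of_conj hg1 hg2
  choose b m hbm using fun Λ : MaxOrder q => exists_eq_ballVertex (Λ.conj g)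
  let i (Λ : MaxOrder q) : ℤ := ballMeet 0 (m Λ) (b Λ) (m Λ)
  have him (Λ) : i Λ ≤ m Λ := (le_ballMeet_iff.1 (le_refl (i Λ))).1
  have hib (Λ) : b Λ ∈ fracIdeal q (i Λ) := by
    simpa using (le_ballMeet_iff.1 (le_refl (i Λ))).2.2
  have hd1 (Λ) : ((bruhatTitsTree q).dist Λ₁ Λ : ℤ) = m Λ - 2 * min 0 (i Λ) := by
    rw [← dist_conj g, hg1, hbm, dist_ballVertex, ballMeet_zero_eq_min, zero_add]
  have hd2 (Λ) : ((bruhatTitsTree q).dist Λ₂ Λ : ℤ) = d + m Λ - 2 * min (d : ℤ) (i Λ) := by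
    rw [← dist_conj g, hg2, hbm, dist_ballVertex, ballMeet_zero_eq_min]
  have hd3 (Λ Λ') : ((bruhatTitsTree q).dist Λ Λ' : ℤ) ≤ m Λ + m Λ' - 2 * min (i Λ) (i Λ') := by
    rw [← dist_conj g, hbm, hbm, dist_ballVertex]
    have : min (i Λ) (i Λ') ≤ ballMeet (b Λ) (m Λ) (b Λ') (m Λ') := le_ballMeet_iff.2
      ⟨(min_le_left _ _).trans (him Λ), (min_le_right _ _).trans (him Λ'),
        sub_mem (fracIdeal_mono (min_le_left _ _) (hib Λ))
          (fracIdeal_mono (min_le_right _ _) (hib Λ'))⟩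
    omega
  -- A foot outside the path, or a leg longer than one of the two parts of the path, would give a
  -- distance larger than `d`.
  have hbd (Λ) (hΛ : Λ ∈ S) : 0 ≤ i Λ ∧ i Λ ≤ d ∧ m Λ ≤ 2 * i Λ ∧ m Λ ≤ d := by
    have e1 := hmax Λ₁ h1 Λ hΛ
    have e2 := hmax Λ₂ h2 Λ hΛ
    have e3 := hd1 Λ
    have e4 := hd2 Λ
    have e5 := him Λ
    omega
  -- The member `Λ` hangs off the path at the ball `q ^ (i Λ) ℤ_q`, at distance `m Λ - i Λ`.
  let depth (Λ : MaxOrder q) : ℕ := (m Λ - i Λ).toNat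
  have hdepth (Λ) : (depth Λ : ℤ) = m Λ - i Λ := Int.toNat_of_nonneg (by linarith [him Λ])
  obtain ⟨Λ₃, h3, hc⟩ := S.exists_mem_eq_sup hS depth
  have hle (Λ) (hΛ : Λ ∈ S) : depth Λ ≤ depth Λ₃ := hc ▸ Finset.le_sup hΛ
  refine ⟨g, depth Λ₃, d, ?_, ?_⟩
  · ext X
    have hmem : X ∈ (⨅ Λ ∈ S, Λ.1).map (conjEquiv ℤ_[q] g).toAlgHom ↔
        ∀ Λ ∈ S, X ∈ ballOrder (b Λ) (m Λ) := by
      simp only [mem_map_conjEquiv, Algebra.mem_iInf, ← coe_ballVertex, ← hbm, MaxOrder.coe_conj]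
    rw [Subalgebra.mem_toSubmodule, hmem, mem_span_tripodVec]
    have hmem1 : X ∈ ballOrder (b Λ₁) (m Λ₁) ↔ X ∈ ballOrder 0 0 := by
      rw [← coe_ballVertex, ← coe_ballVertex, ← hbm, hg1]
    have hmem2 : X ∈ ballOrder (b Λ₂) (m Λ₂) ↔ X ∈ ballOrder 0 d := by
      rw [← coe_ballVertex, ← coe_ballVertex, ← hbm, hg2]
    constructor
    · intro h
      have hX0 := hmem1.1 (h Λ₁ h1)
      have hXd := hmem2.1 (h Λ₂ h2)
      obtain ⟨f1, f2, f3, f4⟩ := hbd Λ₃ h3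
      have := (mem_ballOrder_iff_of_mem hX0 hXd f1 f3 f4).1 (h Λ₃ h3)
      obtain ⟨-, hw, hz, -⟩ := mem_ballOrder_zero.1 hX0
      rw [hdepth]
      exact ⟨hw, by simpa using hz, (mem_ballOrder_zero.1 hXd).2.2.2, this⟩
    · rintro ⟨hw, hz, hy, hxw⟩ Λ hΛ
      have hx : X 0 0 ∈ fracIdeal q 0 := by
        simpa using add_mem (fracIdeal_mono (m := 0) (by omega) hxw) hw
      have hX0 : X ∈ ballOrder 0 0 :=
        mem_ballOrder_zero.2 ⟨hx, hw, by simpa using hz, fracIdeal_mono (by omega) hy⟩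
      have hXd : X ∈ ballOrder 0 (d : ℤ) :=
        mem_ballOrder_zero.2 ⟨hx, hw, fracIdeal_mono (by omega) hz, hy⟩
      obtain ⟨f1, f2, f3, f4⟩ := hbd Λ hΛ
      refine (mem_ballOrder_iff_of_mem hX0 hXd f1 f3 f4).2 (fracIdeal_mono ?_ hxw)
      have := hle Λ hΛ
      have := hdepth Λ
      change m Λ - i Λ ≤ _
      omega
  · refine le_antisymm (Finset.sup_le ?_) ?_
    · rintro ⟨A, B, C⟩ hABC
      simp only [Finset.mem_product] at hABC ⊢
      obtain ⟨hA, hB, hC⟩ := hABC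
      have a1 := hbd A hA
      have b1 := hbd B hB
      have c1 := hbd C hC
      have a2 := hle A hA
      have b2 := hle B hB
      have c2 := hle C hC
      have a3 := hdepth A
      have b3 := hdepth B
      have c3 := hdepth C
      have e1 := hd3 A B
      have e2 := hd3 B C
      have e3 := hd3 C A
      -- For feet `i A ≤ i B ≤ i C` the half perimeter is at most
      -- `depth A + depth B - i A + m C ≤ depth B + d`, as `depth A ≤ i A` and `m C ≤ d`.
      omega
    · have hmem : (Λ₁, Λ₂, Λ₃) ∈ S ×ˢ S ×ˢ S := by simp [h1, h2, h3]
      refine le_trans ?_ (Finset.le_sup hmem)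
      have e1 := hd1 Λ₃
      have e2 := hd2 Λ₃
      rw [SimpleGraph.dist_comm] at e1
      have e3 := hdepth Λ₃
      have e4 := hbd Λ₃ h3
      simp only
      omega

end

theorem lemma3 (q : ℕ) [Fact q.Prime] (S : Finset (MaxOrder q)) (hS : S.Nonempty) :
    IsLocalOrder q (⨅ Λ ∈ S, Λ.1) ∧
    (∃ Δ : ℤ_[q], IsReducedDiscriminant (⨅ Λ ∈ S, Λ.1) Δ) ∧
    ∀ Δ : ℤ_[q], IsReducedDiscriminant (⨅ Λ ∈ S, Λ.1) Δ →
      Δ ≠ 0 ∧ (Δ.valuation : ℚ) = (d3 S : ℚ) / 2 := by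
  obtain ⟨g, c, d, h, hd3⟩ := exists_map_iInf_eq_span S hS
  obtain ⟨hex, hall⟩ := discriminant_of_map_conj h
  refine ⟨?_, hex, fun Δ hΔ => ⟨(hall Δ hΔ).1, ?_⟩⟩
  · have := (isLocalOrder_of_span_tripodVec h).map_conjEquiv g⁻¹
    rwa [← map_conjEquiv_mul, inv_mul_cancel, map_conjEquiv_one] at this
  · rw [(hall Δ hΔ).2, hd3]
    push_cast
    ring
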